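/- For integers $k_1,\dots,k_{n-1}\ge 1$ and $k_n\ge 2$ put $$\zeta_-(k_1,\dots,k_n):=\sum_{0<m_1<\cdots<m_n<\infty}\frac{(-1)^{m_n-1}}{m_1^{k_1}\cdots m_n^{k_n}},$$ an absolutely convergent series, and write $\{1\}^{a}$ for $a$ successive entries equal to $1$ (no entry if $a=0$). Binomial coefficients are $\binom{n}{k}=\frac{n(n-1)\cdots(n-k+1)}{k!}$ for $n\in\mathbb{Z}$ and $k\in\mathbb{Z}_{\ge 0}$ (so $\binom{-1}{0}=1$), and $\binom{n}{-1}=0$. Let $r\ge 0$ and $s\ge 1$ be integers. Then each of the two sums $$\sum_{i=0}^{r}(-1)^{r-i}\left\{\binom{s-2+i}{i}+\binom{s-1+i}{i}\right\}\zeta_-(\{1\}^{r-i},2s+i),$$ $$\sum_{i=0}^{r}(-1)^{r-i}\,2^{r-i+1}\left\{\binom{2s+i-1}{i}-\binom{2s+i-1}{i-1}\right\}\zeta_-(\{1\}^{r-i},2s+i)$$ is the value of a polynomial with rational coefficients in the Riemann zeta values $\zeta(k)=\sum_{m=1}^{\infty}m^{-k}$, $k\in\mathbb{Z}_{\ge 2}$.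 -/

import Mathlib

/-- The strictly increasing tuples `0 < m₁ < ⋯ < mₙ₊₁` of integers. -/
abbrev IncTuple (n : ℕ) : Type := {m : Fin (n + 1) → ℕ // (∀ j, 0 < m j) ∧ StrictMono m}

/-- The term `z ^ (mₙ₊₁ - 1) / (m₁ ^ k₁ ⋯ mₙ₊₁ ^ kₙ₊₁)` of a multiple polylogarithm value. -/
noncomputable def mplTerm (z : ℂ) {n : ℕ} (k : Fin (n + 1) → ℕ) (m : IncTuple n) : ℂ :=
  z ^ (m.1 (Fin.last n) - 1) / ∏ j, (m.1 j : ℂ) ^ k j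

/-- The multiple polylogarithm value of depth `n + 1` with exponents `k`,
`∑_{0 < m₁ < ⋯ < mₙ₊₁} z ^ (mₙ₊₁ - 1) / (m₁ ^ k₁ ⋯ mₙ₊₁ ^ kₙ₊₁)`. -/
noncomputable def mplValue (z : ℂ) {n : ℕ} (k : Fin (n + 1) → ℕ) : ℂ :=
  ∑' m : IncTuple n, mplTerm z k m

/-- The alternating value `ζ₋(k₁, …, kₙ₊₁)`. -/
noncomputable def zetaMinus {n : ℕ} (k : Fin (n + 1) → ℕ) : ℂ := mplValue (-1) k

/-- The index `({1}^a, b)`, of depth `a + 1`. -/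
def onesThen (a b : ℕ) : Fin (a + 1) → ℕ := Fin.snoc (α := fun _ => ℕ) (fun _ : Fin a => 1) b

/-- The binomial coefficient of integers `n (n - 1) ⋯ (n - k + 1) / k!`, which is `1` for `k = 0`
and every `n`, and `0` for `k < 0`. -/
def intBinom (n k : ℤ) : ℤ := if 0 ≤ k then Ring.choose n k.toNat else 0

/-- `x` is the value of a polynomial with rational coefficients at finitely many of the Riemann
zeta values `ζ(2), ζ(3), ζ(4), …`. -/
def IsRatPolyInZetaValues (x : ℂ) : Prop :=
  ∃ P : MvPolynomial {k : ℕ // 2 ≤ k} ℚ,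
    x = MvPolynomial.aeval (fun k : {k : ℕ // 2 ≤ k} => riemannZeta (k.1 : ℂ)) P

/-! Work in `ℂ⟦X⟧` with the nodes `z_n = (n+1)(n+1-X)` and their inverses `x_n`, and compute the
limit, as `N → ∞`, of the complete homogeneous symmetric function `h_s(x_0, …, x_{N-1})` in two
ways.

Newton's identity (`hsymm_newton`) makes `h_s` a rational polynomial in the power sums `∑ x_n^k`.
The `X^r`-coefficient of such a sum tends to an integer multiple of `ζ(2k+r)`, so every coefficient
of the limit lies in the algebra generated by zeta values (`tendsto_coeff_coeff_hsymmSeries_mem`).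

Partial fractions instead give `h_s = ∑_m w_m x_m^s`. Since `z_n - z_m = (n-m)(n+m+2-X)`, the
weights are explicit, and dominated convergence replaces them by `(-1)^m (2 - X/(m+1)) ∏_{j≤m} (1 -
X/j)`. The product generates the harmonic sums inside `ζ₋({1}^a, b)`, and `(2 - X/(m+1)) (1 -
X/(m+1))^{-s}` produces the binomials: the `X^r`-coefficient is the first sum (`first_sum_mem`).

The second sum is a rational combination of first sums with `(r, s)` replaced by `(r-2j, s+j)`. This
follows from expanding `2(1-2X)(1-X)^{-2s-1}` in powers of `X²/(1-2X)`, using `(1-X)² = (1-2X) + X²`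
(`exists_two_mul_oneSubMulX_expansion`, `second_sum_mem`). -/

open scoped PowerSeries

/-! ### Symmetric functions, partial fractions and binomial expansions through geometric series. -/

section Geometric

variable {R : Type*} [CommRing R]

/-- The geometric series `1 / (1 - a X)`. -/
def geomSeries (a : R) : R⟦X⟧ := PowerSeries.mk fun n => a ^ n

/-- The power series `1 - a X`. -/
noncomputable def oneSubMulX (a : R) : R⟦X⟧ := 1 - PowerSeries.C a * PowerSeries.X

theorem coeff_geomSeries (a : R) (n : ℕ) : PowerSeries.coeff n (geomSeries a) = a ^ n := by
  simp [geomSeries]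

theorem oneSubMulX_mul_geomSeries (a : R) : oneSubMulX a * geomSeries a = 1 := by
  ext n
  rcases n with _ | n
  · simp [oneSubMulX, geomSeries]
  · simp [oneSubMulX, sub_mul, mul_assoc, coeff_geomSeries, PowerSeries.coeff_succ_X_mul,
      PowerSeries.coeff_one, pow_succ']

theorem coeff_succ_oneSubMulX_mul (a : R) (f : R⟦X⟧) (n : ℕ) :
    PowerSeries.coeff (n + 1) (oneSubMulX a * f) =
      PowerSeries.coeff (n + 1) f - a * PowerSeries.coeff n f := by
  simp [oneSubMulX, sub_mul, mul_assoc, PowerSeries.coeff_succ_X_mul]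

/-- The binomial has an integer upper entry because `s = 0` must be covered: there it is `i - 1`,
and `binom(-1, 0) = 1` gives the constant term. The induction is Pascal's rule, read off from `(1 -
aX)(1 - aX)^{-s-1} = (1 - aX)^{-s}`. -/
theorem coeff_geomSeries_pow (a : R) (s i : ℕ) :
    PowerSeries.coeff i (geomSeries a ^ s) = (Ring.choose ((s : ℤ) - 1 + i) i : ℤ) * a ^ i := by
  induction s generalizing i with
  | zero =>
    rcases i with _ | i
    · simp
    · have h : ((0 : ℕ) : ℤ) - 1 + ((i + 1 : ℕ) : ℤ) = (i : ℕ) := by push_cast; ring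
      rw [h, Ring.choose_natCast]
      simp [PowerSeries.coeff_one]
  | succ s ih =>
    induction i with
    | zero => simp [geomSeries]
    | succ i ihi =>
      have h := coeff_succ_oneSubMulX_mul a (geomSeries a ^ (s + 1)) i
      rw [pow_succ', ← mul_assoc, oneSubMulX_mul_geomSeries, one_mul, ih, ← pow_succ', ihi] at h
      have e : (((s + 1 : ℕ) : ℤ) - 1 + ((i + 1 : ℕ) : ℤ)) = ((s : ℤ) + i) + 1 := by push_cast; ring
      have e' : (((s + 1 : ℕ) : ℤ) - 1 + (i : ℤ)) = (s : ℤ) + i := by push_cast; ring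
      have e'' : ((s : ℤ) - 1 + ((i + 1 : ℕ) : ℤ)) = (s : ℤ) + i := by push_cast; ring
      rw [e, Ring.choose_succ_succ]
      rw [e', e''] at h
      push_cast
      rw [← sub_eq_zero] at h ⊢
      rw [← neg_eq_zero, ← h]
      ring

/-- The generating function of `h_k`, the complete homogeneous symmetric functions. -/
noncomputable def hsymmSeries {ι : Type*} (S : Finset ι) (x : ι → R) : R⟦X⟧ := ∏ n ∈ S, geomSeries (x n)

/-- The generating function `∑_{k ≥ 1} p_k X ^ k` of the power sums `p_k`. -/
noncomputable def psumSeries {ι : Type*} (S : Finset ι) (x : ι → R) : R⟦X⟧ :=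
  ∑ n ∈ S, PowerSeries.X * PowerSeries.C (x n) * geomSeries (x n)

theorem X_mul_derivative_geomSeries (a : R) :
    PowerSeries.X * PowerSeries.derivative R (geomSeries a) =
      geomSeries a * (PowerSeries.X * PowerSeries.C a * geomSeries a) := by
  have h : PowerSeries.derivative R (oneSubMulX a * geomSeries a) = 0 := by
    rw [oneSubMulX_mul_geomSeries]; simp
  have hl : PowerSeries.derivative R (oneSubMulX a) = -PowerSeries.C a := by
    simp [oneSubMulX, Derivation.leibniz]
  rw [Derivation.leibniz, hl, smul_eq_mul, smul_eq_mul] at h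
  linear_combination (PowerSeries.X * geomSeries a) * h -
    (PowerSeries.X * PowerSeries.derivative R (geomSeries a)) * oneSubMulX_mul_geomSeries a

/-- The logarithmic derivative of a product is the sum of those of its factors. Comparing
coefficients gives Newton's identity. -/
theorem X_mul_derivative_hsymmSeries {ι : Type*} (S : Finset ι) (x : ι → R) :
    PowerSeries.X * PowerSeries.derivative R (hsymmSeries S x) =
      hsymmSeries S x * psumSeries S x := by
  classical
  induction S using Finset.induction_on with
  | empty => simp [hsymmSeries, psumSeries]
  | insert n S hn ih =>
    simp only [hsymmSeries, psumSeries, Finset.prod_insert hn, Finset.sum_insert hn] at ih ⊢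
    rw [Derivation.leibniz, smul_eq_mul, smul_eq_mul]
    linear_combination geomSeries (x n) * ih +
      (∏ n ∈ S, geomSeries (x n)) * X_mul_derivative_geomSeries (x n)

/-- Newton's identity for the complete homogeneous symmetric functions. -/
theorem hsymm_newton {ι : Type*} (S : Finset ι) (x : ι → R) (s : ℕ) :
    ((s + 1 : ℕ) : R) * PowerSeries.coeff (s + 1) (hsymmSeries S x) =
      ∑ k ∈ Finset.range (s + 1),
        PowerSeries.coeff (s - k) (hsymmSeries S x) * ∑ n ∈ S, x n ^ (k + 1) := by
  have h := congrArg (PowerSeries.coeff (s + 1)) (X_mul_derivative_hsymmSeries S x)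
  have hp : psumSeries S x = PowerSeries.X * PowerSeries.mk fun k => ∑ n ∈ S, x n ^ (k + 1) := by
    rw [psumSeries]
    simp_rw [mul_assoc]
    rw [← Finset.mul_sum]
    congr 1
    ext k
    simp [coeff_geomSeries, pow_succ']
  rw [hp, mul_left_comm, PowerSeries.coeff_succ_X_mul, PowerSeries.coeff_succ_X_mul,
    PowerSeries.coeff_derivative, mul_comm (hsymmSeries S x), PowerSeries.coeff_mul,
    Finset.Nat.sum_antidiagonal_eq_sum_range_succ_mk] at h
  push_cast
  rw [mul_comm, h]
  exact Finset.sum_congr rfl fun k _ => by simp [mul_comm]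

/-- Partial fractions: if the `z n`, `n ∈ S`, are distinct with inverses `x n` and
`w m = ∏_{n ≠ m} (1 - x n z m)⁻¹`, then `∏ n, (1 - x n X)⁻¹ = ∑ m, w m (1 - x m X)⁻¹`. -/
theorem hsymmSeries_partialFractions [IsDomain R] {ι : Type*} [DecidableEq ι] (S : Finset ι)
    (hS : S.Nonempty) (z x w : ι → R) (hz : Set.InjOn z S) (hx : ∀ n ∈ S, x n * z n = 1)
    (hw : ∀ m ∈ S, w m * ∏ n ∈ S.erase m, (1 - x n * z m) = 1) :
    hsymmSeries S x = ∑ m ∈ S, PowerSeries.C (w m) * geomSeries (x m) := by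
  classical
  -- Lagrange interpolation of the constant 1: the degree is below `|S|`, and at `z m` only the
  -- `m`-th summand survives, with value 1 by the choice of `w m`.
  have hpoly : ∑ m ∈ S, Polynomial.C (w m) *
      ∏ n ∈ S.erase m, (1 - Polynomial.C (x n) * Polynomial.X) = 1 := by
    refine Polynomial.eq_of_degrees_lt_of_eval_finset_eq (S.image z) ?_ ?_ ?_
    · rw [Finset.card_image_of_injOn hz]
      have hc : 0 < S.card := hS.card_pos
      refine (Polynomial.degree_sum_le _ _).trans_lt ?_
      rw [Finset.sup_lt_iff (by simp)]
      intro m hm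
      have h1 : ∀ n ∈ S.erase m, (1 - Polynomial.C (x n) * Polynomial.X).natDegree ≤ 1 := by
        intro n _
        compute_degree
      have h2 : (∏ n ∈ S.erase m, (1 - Polynomial.C (x n) * Polynomial.X)).natDegree
          ≤ S.card - 1 := by
        refine (Polynomial.natDegree_prod_le _ _).trans ((Finset.sum_le_sum h1).trans ?_)
        simp [Finset.card_erase_of_mem hm]
      have h3 := (Polynomial.natDegree_C_mul_le (w m)
        (∏ n ∈ S.erase m, (1 - Polynomial.C (x n) * Polynomial.X))).trans h2
      refine Polynomial.degree_le_natDegree.trans_lt ?_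
      exact_mod_cast lt_of_le_of_lt h3 (by omega)
    · rw [Finset.card_image_of_injOn hz, Polynomial.degree_one]
      exact_mod_cast hS.card_pos
    · intro y hy
      obtain ⟨m, hm, rfl⟩ := Finset.mem_image.1 hy
      rw [Polynomial.eval_finsetSum, Finset.sum_eq_single_of_mem m hm]
      · simpa [Polynomial.eval_prod] using hw m hm
      · intro l _ hlm
        rw [Polynomial.eval_mul, Polynomial.eval_prod,
          Finset.prod_eq_zero (Finset.mem_erase.2 ⟨hlm.symm, hm⟩), mul_zero]
        simp [hx m hm]
  have hps := congrArg (Polynomial.coeToPowerSeries.ringHom (R := R)) hpoly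
  simp only [map_sum, map_mul, map_prod, map_sub, map_one,
    Polynomial.coeToPowerSeries.ringHom_apply, Polynomial.coe_C, Polynomial.coe_X] at hps
  rw [← mul_one (hsymmSeries S x), ← hps, Finset.mul_sum]
  refine Finset.sum_congr rfl fun m hm => ?_
  have hprod : (∏ n ∈ S.erase m, geomSeries (x n)) *
      ∏ n ∈ S.erase m, (1 - PowerSeries.C (x n) * PowerSeries.X) = 1 := by
    rw [← Finset.prod_mul_distrib]
    exact Finset.prod_eq_one fun n _ => by rw [mul_comm]; exact oneSubMulX_mul_geomSeries _
  rw [hsymmSeries, ← Finset.mul_prod_erase S _ hm]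
  linear_combination (geomSeries (x m) * PowerSeries.C (w m)) * hprod

/-- A truncated form of `(1 - v) ^ (-s - 1) = ∑ⱼ C(s + j, j) v ^ j`. -/
theorem exists_one_sub_pow_mul_sum_choose (v : R) (s M : ℕ) :
    ∃ q : R, (1 - v) ^ (s + 1) * ∑ j ∈ Finset.range M, ((s + j).choose j : R) * v ^ j =
      1 + v ^ M * q := by
  induction s with
  | zero =>
    refine ⟨-1, ?_⟩
    have := mul_neg_geom_sum v M
    simp only [zero_add, Nat.choose_self, Nat.cast_one, one_mul, pow_one]
    rw [this]
    ring
  | succ s ih =>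
    obtain ⟨q, hq⟩ := ih
    -- Multiplication by `1 - v` lowers `s + 1` to `s` by Pascal's rule; only the boundary term at
    -- `v^(M+1)` is left over.
    have step : ∀ M : ℕ, (1 - v) * ∑ j ∈ Finset.range (M + 1), ((s + 1 + j).choose j : R) * v ^ j =
        ∑ j ∈ Finset.range (M + 1), ((s + j).choose j : R) * v ^ j -
          ((s + 1 + M).choose M : R) * v ^ (M + 1) := by
      intro M
      induction M with
      | zero => simp
      | succ M ihM =>
        rw [Finset.sum_range_succ, mul_add, ihM, Finset.sum_range_succ _ (M + 1)]
        have hc : (s + 1 + (M + 1)).choose (M + 1) =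
            (s + 1 + M).choose M + (s + (M + 1)).choose (M + 1) := by
          rw [show s + 1 + (M + 1) = (s + 1 + M) + 1 by ring, Nat.choose_succ_succ,
            show s + (M + 1) = s + 1 + M by ring]
        rw [hc]
        push_cast
        ring
    rcases M with _ | M
    · exact ⟨-1, by simp⟩
    · refine ⟨q - (1 - v) ^ (s + 1) * ((s + 1 + M).choose M : R), ?_⟩
      rw [pow_succ, mul_assoc, step, mul_sub, hq]
      ring

/-- A truncated expansion of `2 (1 - 2 X) (1 - X) ^ (-2 s - 1)` in powers of
`X ^ 2 / (1 - 2 X)`. -/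
theorem exists_two_mul_oneSubMulX_expansion (s M : ℕ) :
    ∃ q : R⟦X⟧, 2 * (oneSubMulX 2 * geomSeries 1 ^ (2 * s + 1)) =
      ∑ j ∈ Finset.range M, (((-1) ^ j * ((s + j).choose j : R⟦X⟧)) *
        (PowerSeries.X ^ (2 * j) * (geomSeries 2 ^ (s + j) * (2 * oneSubMulX 1)))) +
        PowerSeries.X ^ (2 * M) * q := by
  obtain ⟨q, hq⟩ := exists_one_sub_pow_mul_sum_choose
    (-(PowerSeries.X ^ 2 * geomSeries (2 : R))) s M
  have hg1 := oneSubMulX_mul_geomSeries (1 : R)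
  have hg2 := oneSubMulX_mul_geomSeries (2 : R)
  have hsq : 1 - -(PowerSeries.X ^ 2 * geomSeries (2 : R)) =
      oneSubMulX 1 ^ 2 * geomSeries 2 := by
    rw [← hg2]
    have : (oneSubMulX (2 : R)) + PowerSeries.X ^ 2 = oneSubMulX 1 ^ 2 := by
      simp only [oneSubMulX, map_one, map_ofNat]
      ring
    rw [← this]
    ring
  set T := ∑ j ∈ Finset.range M, ((s + j).choose j : R⟦X⟧) *
    (-(PowerSeries.X ^ 2 * geomSeries (2 : R))) ^ j with hT
  have hsum : ∑ j ∈ Finset.range M, (((-1) ^ j * ((s + j).choose j : R⟦X⟧)) *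
        (PowerSeries.X ^ (2 * j) * (geomSeries 2 ^ (s + j) * (2 * oneSubMulX 1)))) =
      2 * oneSubMulX (1 : R) * geomSeries 2 ^ s * T := by
    rw [hT, Finset.mul_sum]
    refine Finset.sum_congr rfl fun j _ => ?_
    rw [neg_pow (PowerSeries.X ^ 2 * geomSeries (2 : R)), mul_pow, ← pow_mul]
    ring
  rw [hsq, mul_pow, ← pow_mul] at hq
  have h1 : oneSubMulX (1 : R) ^ (2 * s + 1) * geomSeries 1 ^ (2 * s + 1) = 1 := by
    rw [← mul_pow, hg1, one_pow]
  refine ⟨-(2 * oneSubMulX 2 * geomSeries 1 ^ (2 * s + 1) * (-geomSeries 2) ^ M * q), ?_⟩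
  rw [hsum]
  have hv : (-(PowerSeries.X ^ 2 * geomSeries (2 : R))) ^ M =
      PowerSeries.X ^ (2 * M) * (-geomSeries 2) ^ M := by
    rw [pow_mul, ← mul_pow]; ring
  rw [hv] at hq
  linear_combination (-2 * oneSubMulX (2 : R) * geomSeries 1 ^ (2 * s + 1)) * hq +
    (2 * oneSubMulX (2 : R) * oneSubMulX 1 * geomSeries 2 ^ (s + 1) * T) * h1 +
    (2 * oneSubMulX (1 : R) * geomSeries 2 ^ s * T) * hg2

end Geometric

/-! ### Coefficient bounds and the summable majorant. -/

section Coefficients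

/-- The `r`-th coefficient of `f` is at most `a ^ r` in norm, for every `r`. -/
def CoeffLePow (a : ℝ) (f : ℂ⟦X⟧) : Prop := ∀ r, ‖PowerSeries.coeff r f‖ ≤ a ^ r

namespace CoeffLePow

theorem nonneg {a : ℝ} {f : ℂ⟦X⟧} (hf : CoeffLePow a f) : 0 ≤ a := by
  simpa using (norm_nonneg _).trans (hf 1)

theorem mono {a b : ℝ} {f : ℂ⟦X⟧} (hf : CoeffLePow a f) (h : a ≤ b) : CoeffLePow b f :=
  fun r => (hf r).trans (pow_le_pow_left₀ hf.nonneg h r)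

theorem one : CoeffLePow 0 (1 : ℂ⟦X⟧) := by
  intro r
  rcases r with _ | r <;> simp [PowerSeries.coeff_one]

/-- The convolution `∑ a^k b^(r-k)` is dominated termwise by the binomial expansion of `(a + b)^r`.
Bounds thus add under products, so products over `1/j` are controlled by harmonic numbers. -/
theorem mul {a b : ℝ} {f g : ℂ⟦X⟧} (hf : CoeffLePow a f) (hg : CoeffLePow b g) :
    CoeffLePow (a + b) (f * g) := by
  intro r
  have ha := hf.nonneg
  have hb := hg.nonneg
  rw [PowerSeries.coeff_mul, (Commute.all a b).add_pow']
  refine norm_sum_le_of_le _ fun p hp => ?_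
  rw [norm_mul, nsmul_eq_mul]
  have h1 : (1 : ℝ) ≤ (r.choose p.1 : ℝ) := by
    exact_mod_cast Nat.choose_pos (by have := Finset.HasAntidiagonal.mem_antidiagonal.1 hp; omega)
  calc ‖PowerSeries.coeff p.1 f‖ * ‖PowerSeries.coeff p.2 g‖ ≤ a ^ p.1 * b ^ p.2 :=
        mul_le_mul (hf _) (hg _) (norm_nonneg _) (by positivity)
    _ ≤ _ := le_mul_of_one_le_left (by positivity) h1

theorem prod {ι : Type*} (S : Finset ι) (a : ι → ℝ) (f : ι → ℂ⟦X⟧)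
    (h : ∀ i ∈ S, CoeffLePow (a i) (f i)) : CoeffLePow (∑ i ∈ S, a i) (∏ i ∈ S, f i) := by
  classical
  induction S using Finset.induction_on with
  | empty => simpa using one
  | insert i S hi ih =>
    rw [Finset.sum_insert hi, Finset.prod_insert hi]
    exact (h i (Finset.mem_insert_self i S)).mul
      (ih fun j hj => h j (Finset.mem_insert_of_mem hj))

theorem pow {a : ℝ} {f : ℂ⟦X⟧} (hf : CoeffLePow a f) (s : ℕ) : CoeffLePow (s * a) (f ^ s) := by
  simpa using prod (Finset.range s) (fun _ => a) (fun _ => f) fun _ _ => hf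

theorem C_mul {a : ℝ} {f : ℂ⟦X⟧} (hf : CoeffLePow a f) {c : ℂ} (hc : ‖c‖ ≤ 1) :
    CoeffLePow a (PowerSeries.C c * f) := by
  intro r
  rw [PowerSeries.coeff_C_mul, norm_mul]
  exact (mul_le_of_le_one_left (norm_nonneg _) hc).trans (hf r)

end CoeffLePow

theorem coeffLePow_geomSeries (c : ℂ) : CoeffLePow ‖c‖ (geomSeries c) := by
  intro r
  rw [coeff_geomSeries, norm_pow]

theorem coeffLePow_oneSubMulX (c : ℂ) : CoeffLePow ‖c‖ (oneSubMulX c) := by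
  intro r
  rcases r with _ | _ | r
  · simp [oneSubMulX]
  · simp [oneSubMulX, PowerSeries.coeff_one]
  · simp [oneSubMulX, PowerSeries.coeff_one]

theorem norm_one_div_natCast_succ (n : ℕ) : ‖(1 : ℂ) / ((n : ℂ) + 1)‖ = 1 / ((n : ℝ) + 1) := by
  rw [norm_div, norm_one]
  congr 1
  exact_mod_cast Complex.norm_natCast (n + 1)

/-- The harmonic number `∑_{j ≤ m} 1 / j`. -/
noncomputable def harmonicSum (m : ℕ) : ℝ := ∑ j ∈ Finset.range m, 1 / ((j : ℝ) + 1)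

theorem harmonicSum_nonneg (m : ℕ) : 0 ≤ harmonicSum m :=
  Finset.sum_nonneg fun _ _ => by positivity

theorem harmonicSum_mono {m n : ℕ} (h : m ≤ n) : harmonicSum m ≤ harmonicSum n :=
  Finset.sum_le_sum_of_subset_of_nonneg (Finset.range_mono h) fun _ _ _ => by positivity

theorem harmonicSum_le (m : ℕ) : harmonicSum m ≤ 1 + Real.log m := by
  have h := harmonic_le_one_add_log m
  simpa [harmonic, harmonicSum] using h

theorem summable_harmonicSum_pow_div_sq (c : ℝ) (hc : 0 ≤ c) (r : ℕ) :
    Summable fun m : ℕ => (1 / ((m : ℝ) + 1) ^ 2) * (2 * harmonicSum (m + 1) + c) ^ r := by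
  -- Chosen so that `ε r ≤ 1/2`: with `log x ≤ x^ε / ε`, the `r`-th power costs at most `x^(1/2)`,
  -- and the exponent `3/2 > 1` remains.
  set ε : ℝ := 1 / (2 * ((r : ℝ) + 1)) with hε
  have hε0 : 0 < ε := by positivity
  set K : ℝ := 2 + c + 2 / ε
  have hs : Summable fun m : ℕ => K ^ r * (1 / ((m : ℝ) + 1) ^ (3 / 2 : ℝ)) := by
    refine Summable.mul_left _ ?_
    have h := (summable_nat_add_iff 1).2
      (Real.summable_one_div_nat_rpow.2 (by norm_num : (1 : ℝ) < 3 / 2))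
    simpa using h
  refine Summable.of_nonneg_of_le (fun m => ?_) (fun m => ?_) hs
  · have := harmonicSum_nonneg (m + 1)
    positivity
  · have hm : (1 : ℝ) ≤ (m : ℝ) + 1 := by linarith [(Nat.cast_nonneg m : (0 : ℝ) ≤ m)]
    have hm0 : (0 : ℝ) < (m : ℝ) + 1 := by linarith
    have h0 := harmonicSum_nonneg (m + 1)
    have h1 := harmonicSum_le (m + 1)
    push_cast at h1
    have h2 := Real.log_le_rpow_div hm0.le hε0
    have h3 : 1 ≤ ((m : ℝ) + 1) ^ ε := Real.one_le_rpow hm hε0.le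
    have h4 : 2 * harmonicSum (m + 1) + c ≤ K * ((m : ℝ) + 1) ^ ε := by
      have : (2 + c) * 1 ≤ (2 + c) * ((m : ℝ) + 1) ^ ε := by gcongr
      have e : K * ((m : ℝ) + 1) ^ ε = (2 + c) * ((m : ℝ) + 1) ^ ε +
        2 * (((m : ℝ) + 1) ^ ε / ε) := by simp only [K]; ring
      linarith
    have h5 : (((m : ℝ) + 1) ^ ε) ^ r ≤ ((m : ℝ) + 1) ^ (1 / 2 : ℝ) := by
      rw [← Real.rpow_natCast, ← Real.rpow_mul hm0.le]
      refine Real.rpow_le_rpow_of_exponent_le hm ?_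
      rw [hε, div_mul_eq_mul_div, div_le_div_iff₀ (by positivity) (by norm_num)]
      linarith
    have h6 : (2 * harmonicSum (m + 1) + c) ^ r ≤ K ^ r * ((m : ℝ) + 1) ^ (1 / 2 : ℝ) := by
      refine (pow_le_pow_left₀ (by positivity) h4 r).trans ?_
      rw [mul_pow]
      gcongr
    have h7 : 1 / ((m : ℝ) + 1) ^ 2 * ((m : ℝ) + 1) ^ (1 / 2 : ℝ) =
        1 / ((m : ℝ) + 1) ^ (3 / 2 : ℝ) := by
      rw [one_div_mul_eq_div, ← Real.rpow_natCast, ← Real.rpow_sub hm0, one_div (_ ^ (3 / 2 : ℝ)),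
        ← Real.rpow_neg hm0.le]
      norm_num
    calc _ ≤ 1 / ((m : ℝ) + 1) ^ 2 * (K ^ r * ((m : ℝ) + 1) ^ (1 / 2 : ℝ)) := by gcongr
      _ = K ^ r * (1 / ((m : ℝ) + 1) ^ 2 * ((m : ℝ) + 1) ^ (1 / 2 : ℝ)) := by ring
      _ = _ := by rw [h7]

end Coefficients

/-! ### The partial fraction weights at the nodes and their limit. -/

section Weights

/-- The power series `∏_{j ≤ m} (1 - X / j)`. -/
noncomputable def prodOneSub (m : ℕ) : ℂ⟦X⟧ :=
  ∏ j ∈ Finset.range m, oneSubMulX (1 / ((j : ℂ) + 1))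

/-- The linear series `k - X`. -/
noncomputable def subX (k : ℂ) : ℂ⟦X⟧ := PowerSeries.C k - PowerSeries.X

/-- The inverse of `subX k`. -/
noncomputable def subXInv (k : ℂ) : ℂ⟦X⟧ := PowerSeries.C (1 / k) * geomSeries (1 / k)

/-- The node `(n + 1) (n + 1 - X)`. -/
noncomputable def node (n : ℕ) : ℂ⟦X⟧ := PowerSeries.C ((n : ℂ) + 1) * subX ((n : ℂ) + 1)

/-- The inverse of `node n`. -/
noncomputable def nodeInv (n : ℕ) : ℂ⟦X⟧ :=
  PowerSeries.C (1 / ((n : ℂ) + 1)) * subXInv ((n : ℂ) + 1)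

/-- The factor `∏_{n ≤ m} (N - n) / (N + n + 1 - X)`, which tends to `1` as `N` grows. -/
noncomputable def weightRatio (N m : ℕ) : ℂ⟦X⟧ :=
  ∏ n ∈ Finset.range (m + 1),
    (PowerSeries.C ((N : ℂ) - n) * subXInv ((N : ℂ) + n + 1))

/-- The limit of the partial fraction weights: `(-1) ^ m (2 m + 2 - X) / (m + 1) ∏_{j ≤ m} (1 - X / j)`. -/
noncomputable def limitWeight (m : ℕ) : ℂ⟦X⟧ :=
  PowerSeries.C ((-1) ^ m) * (2 * oneSubMulX (1 / (2 * ((m : ℂ) + 1)))) * prodOneSub m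

theorem subX_eq {k : ℂ} (hk : k ≠ 0) : subX k = PowerSeries.C k * oneSubMulX (1 / k) := by
  rw [subX, oneSubMulX, mul_sub, ← mul_assoc, ← map_mul]
  simp [hk]

theorem subX_mul_subXInv {k : ℂ} (hk : k ≠ 0) : subX k * subXInv k = 1 := by
  rw [subX_eq hk, subXInv, mul_mul_mul_comm, oneSubMulX_mul_geomSeries, ← map_mul]
  simp [hk]

theorem C_mul_C_one_div {k : ℂ} (hk : k ≠ 0) :
    PowerSeries.C k * PowerSeries.C (1 / k) = (1 : ℂ⟦X⟧) := by
  rw [← map_mul, mul_one_div_cancel hk, map_one]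

theorem natCast_succ_ne_zero (n : ℕ) : (n : ℂ) + 1 ≠ 0 := by exact_mod_cast n.succ_ne_zero

theorem nodeInv_mul_node (n : ℕ) : nodeInv n * node n = 1 := by
  have hn := natCast_succ_ne_zero n
  rw [nodeInv, node, mul_mul_mul_comm, mul_comm (subXInv _), subX_mul_subXInv hn, mul_one,
    mul_comm, C_mul_C_one_div hn]

/-- This factorization is the reason for choosing these nodes: the products over `n ≠ m` in the
weights become telescoping products of linear factors. -/
theorem node_sub_node (n m : ℕ) :
    node n - node m = PowerSeries.C ((n : ℂ) - m) * subX ((n : ℂ) + m + 2) := by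
  simp only [node, subX, map_add, map_sub, map_one, map_ofNat]
  ring

theorem node_injective : Function.Injective node := by
  intro n m h
  have h0 := congrArg (PowerSeries.coeff 1) (sub_eq_zero.2 h)
  rw [node_sub_node] at h0
  rw [PowerSeries.coeff_C_mul, subX, map_sub, PowerSeries.coeff_C, PowerSeries.coeff_one_X] at h0
  simp only [one_ne_zero, if_false, zero_sub, mul_neg, mul_one, neg_sub, map_zero] at h0
  exact_mod_cast (sub_eq_zero.1 h0).symm

theorem one_sub_nodeInv_mul_node (n m : ℕ) :
    1 - nodeInv n * node m =
      PowerSeries.C (1 / ((n : ℂ) + 1)) * subXInv ((n : ℂ) + 1) *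
        (PowerSeries.C ((n : ℂ) - m) * subX ((n : ℂ) + m + 2)) := by
  rw [← node_sub_node, ← nodeInv, mul_sub, nodeInv_mul_node]

theorem prod_range_sub_self (m : ℕ) :
    ∏ n ∈ Finset.range m, ((m : ℂ) - n) = ∏ n ∈ Finset.range m, ((n : ℂ) + 1) := by
  induction m with
  | zero => simp
  | succ m ih =>
    rw [Finset.prod_range_succ', Finset.prod_range_succ _ m, ← ih]
    simp

/-- Adding the node `N` multiplies the weight by `(1 - x_N z_m)⁻¹`. In the quotient of the two
products of `m + 1` factors all but the end factors cancel; `hD` does this for the numerators and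
`hV` for the denominators. -/
theorem weightRatio_succ_mul (N m : ℕ) :
    weightRatio (N + 1) m * (1 - nodeInv N * node m) = weightRatio N m := by
  have hu : subX ((N : ℂ) + m + 2) * subXInv ((N : ℂ) + m + 2) = 1 :=
    subX_mul_subXInv (by exact_mod_cast (by omega : N + m + 2 ≠ 0))
  have hc := C_mul_C_one_div (natCast_succ_ne_zero N)
  rw [one_sub_nodeInv_mul_node]
  have hD : (∏ n ∈ Finset.range (m + 1), PowerSeries.C (((N + 1 : ℕ) : ℂ) - n)) *
      PowerSeries.C ((N : ℂ) - m) =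
      PowerSeries.C ((N : ℂ) + 1) * ∏ n ∈ Finset.range (m + 1), (PowerSeries.C ((N : ℂ) - n) : ℂ⟦X⟧) := by
    rw [Finset.prod_range_succ', Finset.prod_range_succ _ m]
    have : ∀ n : ℕ, (((N + 1 : ℕ) : ℂ) - ((n + 1 : ℕ) : ℂ)) = (N : ℂ) - n := by
      intro n; push_cast; ring
    simp only [this]
    push_cast
    simp only [sub_zero]
    ring
  have hV : subXInv ((N : ℂ) + 1) *
      (∏ n ∈ Finset.range (m + 1), subXInv (((N + 1 : ℕ) : ℂ) + n + 1)) =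
      (∏ n ∈ Finset.range (m + 1), subXInv ((N : ℂ) + n + 1)) * subXInv ((N : ℂ) + m + 2) := by
    rw [Finset.prod_range_succ, Finset.prod_range_succ' _ m]
    have h1 : ∀ n : ℕ, (((N + 1 : ℕ) : ℂ) + n + 1) = (N : ℂ) + ((n + 1 : ℕ) : ℂ) + 1 := by
      intro n; push_cast; ring
    simp only [h1]
    rw [show (N : ℂ) + ((m + 1 : ℕ) : ℂ) + 1 = (N : ℂ) + m + 2 by push_cast; ring]
    push_cast
    simp only [add_zero]
    ring
  simp only [weightRatio, Finset.prod_mul_distrib]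
  generalize (∏ n ∈ Finset.range (m + 1), PowerSeries.C (((N + 1 : ℕ) : ℂ) - n)) = D' at *
  generalize (∏ n ∈ Finset.range (m + 1), (PowerSeries.C ((N : ℂ) - n) : ℂ⟦X⟧)) = D at *
  generalize (∏ n ∈ Finset.range (m + 1), subXInv (((N + 1 : ℕ) : ℂ) + n + 1)) = V' at *
  generalize (∏ n ∈ Finset.range (m + 1), subXInv ((N : ℂ) + n + 1)) = V at *
  generalize subX ((N : ℂ) + m + 2) = u at *
  generalize subXInv ((N : ℂ) + m + 2) = v at *
  generalize subXInv ((N : ℂ) + 1) = v₁ at *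
  generalize (PowerSeries.C ((N : ℂ) + 1) : ℂ⟦X⟧) = c at *
  generalize (PowerSeries.C (1 / ((N : ℂ) + 1)) : ℂ⟦X⟧) = c' at *
  generalize (PowerSeries.C ((N : ℂ) - m) : ℂ⟦X⟧) = d at *
  linear_combination (c' * u * v₁ * V') * hD + (c * D * c' * u) * hV + (c * D * c' * V) * hu +
    (D * V) * hc

/-- The base case `N = m + 1` of the weight formula; larger `N` follow by `weightRatio_succ_mul`. -/
theorem limitWeight_mul_prod_self (m : ℕ) :
    limitWeight m * weightRatio (m + 1) m *
      ∏ n ∈ Finset.range m, (1 - nodeInv n * node m) = 1 := by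
  have h2m : (2 * ((m : ℂ) + 1)) ≠ 0 := mul_ne_zero two_ne_zero (natCast_succ_ne_zero m)
  have hlin : (2 : ℂ⟦X⟧) * oneSubMulX (1 / (2 * ((m : ℂ) + 1))) =
      PowerSeries.C (1 / ((m : ℂ) + 1)) * subX ((m : ℂ) + m + 2) := by
    rw [show (m : ℂ) + m + 2 = 2 * ((m : ℂ) + 1) by ring, subX_eq h2m, ← mul_assoc, ← map_mul,
      show 1 / ((m : ℂ) + 1) * (2 * ((m : ℂ) + 1)) = 2 by
        field_simp [natCast_succ_ne_zero m], map_ofNat]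
  have hP : prodOneSub m = ∏ j ∈ Finset.range m,
      (PowerSeries.C (1 / ((j : ℂ) + 1)) * subX ((j : ℂ) + 1)) := by
    refine Finset.prod_congr rfl fun j _ => ?_
    rw [subX_eq (natCast_succ_ne_zero j), ← mul_assoc, mul_comm (PowerSeries.C _),
      C_mul_C_one_div (natCast_succ_ne_zero j), one_mul]
  have hu : subX ((m : ℂ) + m + 2) * subXInv ((m : ℂ) + m + 2) = 1 :=
    subX_mul_subXInv (by exact_mod_cast (by omega : m + m + 2 ≠ 0))
  have hA : (∏ j ∈ Finset.range m, subX ((j : ℂ) + 1)) *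
      ∏ j ∈ Finset.range m, subXInv ((j : ℂ) + 1) = 1 := by
    rw [← Finset.prod_mul_distrib]
    exact Finset.prod_eq_one fun j _ => subX_mul_subXInv (natCast_succ_ne_zero j)
  have hB : (∏ n ∈ Finset.range m, subX ((n : ℂ) + m + 2)) *
      ∏ n ∈ Finset.range m, subXInv (((m + 1 : ℕ) : ℂ) + n + 1) = 1 := by
    rw [← Finset.prod_mul_distrib]
    refine Finset.prod_eq_one fun j _ => ?_
    rw [show ((m + 1 : ℕ) : ℂ) + j + 1 = (j : ℂ) + m + 2 by push_cast; ring]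
    exact subX_mul_subXInv (by exact_mod_cast (by omega : j + m + 2 ≠ 0))
  -- The scalar parts: `(m+1)!` and `(-1)^m m!` cancel against `(-1)^m / (m+1)` and two factors
  -- `1/m!`.
  have hconst : ((-1) ^ m * (1 / ((m : ℂ) + 1)) * (∏ j ∈ Finset.range m, 1 / ((j : ℂ) + 1))) *
      (∏ n ∈ Finset.range (m + 1), (((m + 1 : ℕ) : ℂ) - n)) *
      ((∏ j ∈ Finset.range m, 1 / ((j : ℂ) + 1)) * ∏ n ∈ Finset.range m, ((n : ℂ) - m)) = 1 := by
    have h1 : ∏ n ∈ Finset.range m, ((n : ℂ) - m) =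
        (-1) ^ m * ∏ n ∈ Finset.range m, ((n : ℂ) + 1) := by
      rw [← prod_range_sub_self, ← Finset.card_range m, ← Finset.prod_const, Finset.card_range,
        ← Finset.prod_mul_distrib]
      exact Finset.prod_congr rfl fun _ _ => by ring
    have h2 : (∏ j ∈ Finset.range m, 1 / ((j : ℂ) + 1)) * ∏ j ∈ Finset.range m, ((j : ℂ) + 1) = 1 := by
      rw [← Finset.prod_mul_distrib]
      exact Finset.prod_eq_one fun j _ => one_div_mul_cancel (natCast_succ_ne_zero j)
    have h3 : ((-1 : ℂ) ^ m) * (-1) ^ m = 1 := by rw [← mul_pow]; simp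
    have h4 := one_div_mul_cancel (natCast_succ_ne_zero m)
    rw [prod_range_sub_self, h1, Finset.prod_range_succ]
    generalize (∏ j ∈ Finset.range m, 1 / ((j : ℂ) + 1)) = p at *
    generalize (∏ j ∈ Finset.range m, ((j : ℂ) + 1)) = q at *
    generalize (-1 : ℂ) ^ m = e at *
    generalize 1 / ((m : ℂ) + 1) = i at *
    linear_combination (p * q * p * q * i * (m + 1)) * h3 + (p * q * p * q) * h4 + (p * q + 1) * h2
  have hconst' := congrArg (PowerSeries.C (R := ℂ)) hconst
  simp only [map_mul, map_prod, map_one] at hconst'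
  simp only [limitWeight, hlin, hP, weightRatio, one_sub_nodeInv_mul_node, Finset.prod_mul_distrib]
  rw [Finset.prod_range_succ (fun n : ℕ => subXInv (((m + 1 : ℕ) : ℂ) + n + 1)),
    show ((m + 1 : ℕ) : ℂ) + m + 1 = (m : ℂ) + m + 2 by push_cast; ring]
  generalize (∏ j ∈ Finset.range m, subX ((j : ℂ) + 1)) = A at *
  generalize (∏ j ∈ Finset.range m, subXInv ((j : ℂ) + 1)) = A' at *
  generalize (∏ n ∈ Finset.range m, subX ((n : ℂ) + m + 2)) = B at *
  generalize (∏ n ∈ Finset.range m, subXInv (((m + 1 : ℕ) : ℂ) + n + 1)) = B' at *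
  generalize subX ((m : ℂ) + m + 2) = u at *
  generalize subXInv ((m : ℂ) + m + 2) = v at *
  linear_combination (u * v * A * A' * B * B') * hconst' + (A * A' * B * B') * hu + B * B' * hA + hB

theorem limitWeight_mul_weightRatio_mul_prod (m K : ℕ) :
    limitWeight m * weightRatio (m + 1 + K) m *
      ∏ n ∈ (Finset.range (m + 1 + K)).erase m, (1 - nodeInv n * node m) = 1 := by
  induction K with
  | zero =>
    rw [add_zero, show (Finset.range (m + 1)).erase m = Finset.range m by ext; simp; omega]
    exact limitWeight_mul_prod_self m
  | succ K ih =>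
    rw [show (Finset.range (m + 1 + (K + 1))).erase m =
      insert (m + 1 + K) ((Finset.range (m + 1 + K)).erase m) by ext; simp; omega,
      Finset.prod_insert (by simp), mul_assoc, ← mul_assoc (weightRatio _ _), ← add_assoc,
      weightRatio_succ_mul, ← mul_assoc, ih]

/-- The complete homogeneous symmetric functions of the `nodeInv n`, `n < N`, by partial
fractions. -/
theorem coeff_hsymmSeries_nodeInv (N s : ℕ) (hN : 0 < N) :
    PowerSeries.coeff s (hsymmSeries (Finset.range N) nodeInv) =
      ∑ m ∈ Finset.range N, limitWeight m * weightRatio N m * nodeInv m ^ s := by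
  rw [hsymmSeries_partialFractions (Finset.range N) ⟨0, by simpa using hN⟩ node nodeInv
    (fun m => limitWeight m * weightRatio N m) node_injective.injOn
    (fun n _ => nodeInv_mul_node n)]
  · simp_rw [map_sum, PowerSeries.coeff_C_mul, coeff_geomSeries]
  · intro m hm
    obtain ⟨K, rfl⟩ := Nat.exists_eq_add_of_le (Nat.succ_le_of_lt (Finset.mem_range.1 hm))
    exact limitWeight_mul_weightRatio_mul_prod m K

theorem weightRatio_eq_zero {N m : ℕ} (h : N ≤ m) : weightRatio N m = 0 :=
  Finset.prod_eq_zero (Finset.mem_range.2 (Nat.lt_succ_of_le h)) (by simp)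

theorem coeffLePow_prodOneSub (m : ℕ) : CoeffLePow (harmonicSum m) (prodOneSub m) :=
  CoeffLePow.prod _ _ _ fun j _ => by
    rw [← norm_one_div_natCast_succ]
    exact coeffLePow_oneSubMulX _

/-- The bound is uniform in `N`, as dominated convergence requires: `|N - n| ≤ N + n + 1` for all
`n`, and `1/(N+n+1) ≤ 1/(n+1)`. -/
theorem coeffLePow_weightRatio (N m : ℕ) :
    CoeffLePow (harmonicSum (m + 1)) (weightRatio N m) :=
  CoeffLePow.prod _ _ _ fun n _ => by
    have h : PowerSeries.C ((N : ℂ) - n) * subXInv ((N : ℂ) + n + 1) =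
        PowerSeries.C (((N : ℂ) - n) / ((N : ℂ) + n + 1)) * geomSeries (1 / ((N : ℂ) + n + 1)) := by
      rw [subXInv, ← mul_assoc, ← map_mul, mul_one_div]
    have hn : ‖(N : ℂ) + n + 1‖ = (N : ℝ) + n + 1 := by
      exact_mod_cast Complex.norm_natCast (N + n + 1)
    have hN : (0 : ℝ) ≤ N := N.cast_nonneg
    have hn' : (0 : ℝ) ≤ n := n.cast_nonneg
    rw [h]
    refine (CoeffLePow.C_mul (coeffLePow_geomSeries _) ?_).mono ?_
    · rw [norm_div, hn, div_le_one (by positivity)]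
      refine (norm_sub_le _ _).trans ?_
      simp
    · rw [norm_div, hn, norm_one]
      exact one_div_le_one_div_of_le (by positivity) (by linarith)

theorem norm_coeff_term_le {s : ℕ} (hs : 1 ≤ s) (N m r : ℕ) :
    ‖PowerSeries.coeff r (limitWeight m * weightRatio N m * nodeInv m ^ s)‖ ≤
      2 * ((1 / ((m : ℝ) + 1) ^ 2) * (2 * harmonicSum (m + 1) + (1 + s)) ^ r) := by
  have hm : (0 : ℝ) ≤ m := m.cast_nonneg
  have hf : limitWeight m * weightRatio N m * nodeInv m ^ s =
      PowerSeries.C ((-1) ^ m * 2 * (1 / ((m : ℂ) + 1)) ^ (2 * s)) *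
        (oneSubMulX (1 / (2 * ((m : ℂ) + 1))) * prodOneSub m * weightRatio N m *
          geomSeries (1 / ((m : ℂ) + 1)) ^ s) := by
    simp only [limitWeight, nodeInv, subXInv, map_mul, map_pow, map_ofNat]
    ring
  have hb : CoeffLePow (2 * harmonicSum (m + 1) + (1 + s))
      (oneSubMulX (1 / (2 * ((m : ℂ) + 1))) * prodOneSub m * weightRatio N m *
          geomSeries (1 / ((m : ℂ) + 1)) ^ s) := by
    refine ((((coeffLePow_oneSubMulX _).mul (coeffLePow_prodOneSub m)).mul
      (coeffLePow_weightRatio N m)).mul ((coeffLePow_geomSeries _).pow s)).mono ?_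
    have h1 : ‖1 / (2 * ((m : ℂ) + 1))‖ ≤ 1 := by
      rw [one_div, mul_inv, norm_mul, ← one_div ((m : ℂ) + 1), norm_one_div_natCast_succ]
      have : 1 / ((m : ℝ) + 1) ≤ 1 := by rw [div_le_one (by positivity)]; linarith
      norm_num
      norm_num at this
      linarith
    have h2 : (s : ℝ) * ‖1 / ((m : ℂ) + 1)‖ ≤ s := by
      rw [norm_one_div_natCast_succ]
      exact mul_le_of_le_one_right s.cast_nonneg (by rw [div_le_one (by positivity)]; linarith)
    linarith [harmonicSum_mono m.le_succ]
  rw [hf, PowerSeries.coeff_C_mul, norm_mul, ← mul_assoc]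
  refine mul_le_mul ?_ (hb r) (norm_nonneg _) (by positivity)
  rw [norm_mul, norm_mul, norm_pow, norm_pow, norm_neg, norm_one, one_pow, one_mul,
    norm_one_div_natCast_succ, Complex.norm_ofNat, ← one_div_pow]
  gcongr 2 * ?_
  exact pow_le_pow_of_le_one (by positivity) (by rw [div_le_one (by positivity)]; linarith)
    (by omega)

open Filter Topology in
theorem tendsto_coeff_weightRatio (f g : ℂ⟦X⟧) (m r : ℕ) :
    Tendsto (fun N => PowerSeries.coeff r (f * weightRatio N m * g)) atTop
      (𝓝 (PowerSeries.coeff r (f * g))) := by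
  open scoped PowerSeries.WithPiTopology in
  have hfac : ∀ n : ℕ, Tendsto (fun N : ℕ =>
      PowerSeries.C ((N : ℂ) - n) * subXInv ((N : ℂ) + n + 1)) atTop (𝓝 1) := by
    intro n
    have hinv : Tendsto (fun N : ℕ => 1 / ((N : ℂ) + n + 1)) atTop (𝓝 0) := by
      have h := (tendsto_add_atTop_iff_nat (n + 1)).2
        (tendsto_inv_atTop_nhds_zero_nat (𝕜 := ℂ))
      refine h.congr fun N => ?_
      push_cast
      rw [one_div, add_assoc]
    rw [PowerSeries.WithPiTopology.tendsto_iff_coeff_tendsto]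
    intro d
    have hc : Tendsto (fun N : ℕ => 1 - (2 * (n : ℂ) + 1) * (1 / ((N : ℂ) + n + 1))) atTop (𝓝 1) := by
      simpa using (hinv.const_mul (2 * (n : ℂ) + 1)).const_sub 1
    have hd := hc.mul (hinv.pow d)
    have hlim : (1 : ℂ) * 0 ^ d = PowerSeries.coeff d (1 : ℂ⟦X⟧) := by
      rcases d with _ | d <;> simp [PowerSeries.coeff_one]
    rw [hlim] at hd
    refine hd.congr fun N => ?_
    have hne : (N : ℂ) + n + 1 ≠ 0 := by exact_mod_cast (N + n).succ_ne_zero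
    rw [subXInv, PowerSeries.coeff_C_mul, PowerSeries.coeff_C_mul, coeff_geomSeries, ← mul_assoc]
    congr 1
    field_simp
    ring
  have hprod : Tendsto (fun N : ℕ => weightRatio N m) atTop (𝓝 1) := by
    simpa [weightRatio] using tendsto_finsetProd (Finset.range (m + 1)) fun n _ => hfac n
  have h := (hprod.const_mul f).mul_const g
  rw [mul_one, PowerSeries.WithPiTopology.tendsto_iff_coeff_tendsto] at h
  exact h r

-- Dominated convergence applies to sums over all `m`, because `weightRatio N m` vanishes for `m ≥
-- N` and extends the finite partial fraction sum by zero.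
open Filter Topology in
theorem tendsto_coeff_coeff_hsymmSeries {s : ℕ} (hs : 1 ≤ s) (r : ℕ) :
    Tendsto (fun N => PowerSeries.coeff r
      (PowerSeries.coeff s (hsymmSeries (Finset.range N) nodeInv))) atTop
      (𝓝 (∑' m, PowerSeries.coeff r (limitWeight m * nodeInv m ^ s))) := by
  have h := tendsto_tsum_of_dominated_convergence (𝓕 := atTop)
    (f := fun N m => PowerSeries.coeff r (limitWeight m * weightRatio N m * nodeInv m ^ s))
    ((summable_harmonicSum_pow_div_sq (1 + s) (by positivity) r).mul_left 2)
    (fun m => tendsto_coeff_weightRatio (limitWeight m) (nodeInv m ^ s) m r)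
    (Eventually.of_forall fun N m => norm_coeff_term_le hs N m r)
  refine h.congr' ?_
  filter_upwards [eventually_gt_atTop 0] with N hN
  rw [coeff_hsymmSeries_nodeInv N s hN, map_sum]
  refine tsum_eq_sum fun m hm => ?_
  rw [weightRatio_eq_zero (by simpa using hm)]
  simp

end Weights

/-! ### The limit lies in the algebra of zeta values. -/

section ZetaAlgebra

/-- The `ℚ`-algebra generated by the zeta values `ζ(2), ζ(3), …`. -/
noncomputable def zetaAlgebra : Subalgebra ℚ ℂ :=
  (MvPolynomial.aeval fun k : {k : ℕ // 2 ≤ k} => riemannZeta (k.1 : ℂ)).range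

theorem isRatPolyInZetaValues_iff {x : ℂ} : IsRatPolyInZetaValues x ↔ x ∈ zetaAlgebra :=
  ⟨fun ⟨P, hP⟩ => ⟨P, hP.symm⟩, fun ⟨P, hP⟩ => ⟨P, hP.symm⟩⟩

theorem riemannZeta_mem_zetaAlgebra {k : ℕ} (hk : 2 ≤ k) : riemannZeta k ∈ zetaAlgebra :=
  ⟨MvPolynomial.X ⟨k, hk⟩, by simp⟩

theorem hasSum_one_div_succ_pow {k : ℕ} (hk : 2 ≤ k) :
    HasSum (fun n : ℕ => (1 / ((n : ℂ) + 1)) ^ k) (riemannZeta k) := by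
  have hs : Summable fun n : ℕ => 1 / (n : ℂ) ^ k := by
    have h := Complex.summable_one_div_nat_cpow (p := (k : ℂ))
    simpa using h.2 (by simpa using Nat.lt_of_succ_le hk)
  have h := hs.hasSum
  rw [← zeta_nat_eq_tsum_of_gt_one hk, ← hasSum_nat_add_iff' 1] at h
  have hk0 : k ≠ 0 := by omega
  simpa [hk0] using h

theorem coeff_nodeInv_pow (n k r : ℕ) :
    PowerSeries.coeff r (nodeInv n ^ k) =
      (Ring.choose ((k : ℤ) - 1 + r) r : ℤ) * (1 / ((n : ℂ) + 1)) ^ (2 * k + r) := by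
  have h : nodeInv n ^ k = PowerSeries.C ((1 / ((n : ℂ) + 1)) ^ (2 * k)) *
      geomSeries (1 / ((n : ℂ) + 1)) ^ k := by
    simp only [nodeInv, subXInv, map_pow]
    ring
  rw [h, PowerSeries.coeff_C_mul, coeff_geomSeries_pow]
  ring

open Filter Topology in
theorem tendsto_coeff_psum_nodeInv (k r : ℕ) :
    ∃ L ∈ zetaAlgebra, Tendsto (fun N => PowerSeries.coeff r
      (∑ n ∈ Finset.range N, nodeInv n ^ (k + 1))) atTop (𝓝 L) := by
  refine ⟨(Ring.choose (((k + 1 : ℕ) : ℤ) - 1 + r) r : ℤ) * riemannZeta ((2 * (k + 1) + r : ℕ) : ℂ),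
    mul_mem (intCast_mem _ _) (riemannZeta_mem_zetaAlgebra (by omega)), ?_⟩
  have h := ((hasSum_one_div_succ_pow (k := 2 * (k + 1) + r) (by omega)).mul_left
    ((Ring.choose (((k + 1 : ℕ) : ℤ) - 1 + r) r : ℤ) : ℂ)).tendsto_sum_nat
  refine h.congr fun N => ?_
  rw [map_sum]
  exact Finset.sum_congr rfl fun n _ => (coeff_nodeInv_pow n (k + 1) r).symm

open Filter Topology in
theorem tendsto_coeff_coeff_hsymmSeries_mem (s r : ℕ) :
    ∃ L ∈ zetaAlgebra, Tendsto (fun N => PowerSeries.coeff r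
      (PowerSeries.coeff s (hsymmSeries (Finset.range N) nodeInv))) atTop (𝓝 L) := by
  induction s using Nat.strong_induction_on generalizing r with
  | _ s ih =>
    rcases s with _ | s
    · refine ⟨PowerSeries.coeff r 1, ?_, ?_⟩
      · rw [PowerSeries.coeff_one]
        split_ifs
        exacts [one_mem _, zero_mem _]
      · have h : ∀ N, PowerSeries.coeff 0 (hsymmSeries (Finset.range N) nodeInv) = 1 := by
          intro N
          rw [PowerSeries.coeff_zero_eq_constantCoeff_apply, hsymmSeries, map_prod]
          refine Finset.prod_eq_one fun n _ => ?_
          rw [← PowerSeries.coeff_zero_eq_constantCoeff_apply, coeff_geomSeries, pow_zero]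
        simp_rw [h]
        exact tendsto_const_nhds
    · choose P hP hPlim using tendsto_coeff_psum_nodeInv
      have ih' : ∀ (k q : ℕ), ∃ L ∈ zetaAlgebra, Tendsto (fun N => PowerSeries.coeff q
          (PowerSeries.coeff (s - k) (hsymmSeries (Finset.range N) nodeInv))) atTop (𝓝 L) :=
        fun k q => ih (s - k) (by omega) q
      choose Q hQ hQlim using ih'
      -- The limit of Newton's identity divided by `s + 1`; this division is why rational
      -- coefficients are needed.
      refine ⟨((s + 1 : ℚ)⁻¹ : ℚ) • ∑ k ∈ Finset.range (s + 1),
        ∑ p ∈ Finset.HasAntidiagonal.antidiagonal r, Q k p.1 * P k p.2, ?_, ?_⟩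
      · exact Subalgebra.smul_mem _ (sum_mem fun k _ => sum_mem fun p _ =>
          mul_mem (hQ _ _) (hP _ _)) _
      · have hlim := (tendsto_finsetSum (Finset.range (s + 1)) fun k _ =>
          tendsto_finsetSum (Finset.HasAntidiagonal.antidiagonal r) fun p _ =>
            (hQlim k p.1).mul (hPlim k p.2)).const_smul ((s + 1 : ℚ)⁻¹ : ℚ)
        refine hlim.congr fun N => ?_
        have h := congrArg (PowerSeries.coeff r) (hsymm_newton (Finset.range N) nodeInv s)
        simp_rw [map_sum, PowerSeries.coeff_mul] at h
        rw [← PowerSeries.coeff_mul, ← map_natCast (PowerSeries.C (R := ℂ)),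
          PowerSeries.coeff_C_mul] at h
        rw [← h, Rat.smul_def]
        push_cast
        rw [inv_mul_cancel_left₀ (natCast_succ_ne_zero s)]

theorem tsum_coeff_limitWeight_mem {s : ℕ} (hs : 1 ≤ s) (r : ℕ) :
    ∑' m, PowerSeries.coeff r (limitWeight m * nodeInv m ^ s) ∈ zetaAlgebra := by
  obtain ⟨L, hL, h⟩ := tendsto_coeff_coeff_hsymmSeries_mem s r
  rwa [tendsto_nhds_unique (tendsto_coeff_coeff_hsymmSeries hs r) h]

end ZetaAlgebra

/-! ### The values `ζ₋({1}^a, b)` as single series over the largest index. -/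

section Tuples

/-- Both sides are the elementary symmetric function `e_a(1, 1/2, …, 1/m)`, which is the inner sum
of `ζ₋({1}^a, b)` when the largest index is `m + 1`. -/
theorem coeff_prodOneSub (a m : ℕ) :
    (-1) ^ a * PowerSeries.coeff a (prodOneSub m) =
      ∑ A ∈ Finset.powersetCard a (Finset.range m), ∏ j ∈ A, 1 / ((j : ℂ) + 1) := by
  have h : prodOneSub m = ∑ A ∈ (Finset.range m).powerset,
      PowerSeries.C ((-1) ^ A.card * ∏ j ∈ A, 1 / ((j : ℂ) + 1)) * PowerSeries.X ^ A.card := by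
    have h1 : prodOneSub m = ∏ j ∈ Finset.range m,
        (1 + PowerSeries.C (-1 * (1 / ((j : ℂ) + 1))) * PowerSeries.X) :=
      Finset.prod_congr rfl fun j _ => by simp [oneSubMulX, sub_eq_add_neg]
    rw [h1, Finset.prod_one_add]
    refine Finset.sum_congr rfl fun A _ => ?_
    rw [Finset.prod_mul_distrib, Finset.prod_const, ← map_prod, Finset.prod_mul_distrib,
      Finset.prod_const]
  rw [h, map_sum, Finset.mul_sum, Finset.powersetCard_eq_filter, Finset.sum_filter]
  refine Finset.sum_congr rfl fun A _ => ?_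
  rw [PowerSeries.coeff_C_mul, PowerSeries.coeff_X_pow]
  by_cases hA : a = A.card
  · rw [if_pos hA, if_pos hA.symm, hA, mul_one, ← mul_assoc, ← mul_pow]
    simp
  · rw [if_neg hA, if_neg (Ne.symm hA)]
    simp

/-- The tuple with last entry `m + 1` whose other entries are the `j + 1`, `j ∈ A`. -/
noncomputable def tupleOfFinset (a : ℕ)
    (p : Σ m : ℕ, {A : Finset ℕ // A ∈ Finset.powersetCard a (Finset.range m)}) : IncTuple a :=
  ⟨Fin.snoc (α := fun _ => ℕ)
    (fun i => p.2.1.orderEmbOfFin (Finset.mem_powersetCard.1 p.2.2).2 i + 1) (p.1 + 1), by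
    constructor
    · intro j
      refine Fin.lastCases ?_ (fun i => ?_) j <;> simp
    · have hmem : ∀ i, p.2.1.orderEmbOfFin (Finset.mem_powersetCard.1 p.2.2).2 i < p.1 := fun i =>
        Finset.mem_range.1 ((Finset.mem_powersetCard.1 p.2.2).1 (Finset.orderEmbOfFin_mem _ _ i))
      intro i j hij
      induction j using Fin.lastCases with
      | last =>
        induction i using Fin.lastCases with
        | last => exact absurd hij (lt_irrefl _)
        | cast i => simpa using hmem i
      | cast j =>
        induction i using Fin.lastCases with
        | last => exact absurd hij (Fin.castSucc_lt_last j).not_gt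
        | cast i => simpa using hij⟩

theorem tupleOfFinset_bijective (a : ℕ) : Function.Bijective (tupleOfFinset a) := by
  constructor
  · rintro ⟨m, A, hA⟩ ⟨n, B, hB⟩ h
    have h0 := congrArg Subtype.val h
    have hlast := congrFun h0 (Fin.last a)
    simp only [tupleOfFinset, Fin.snoc_last, add_left_inj] at hlast
    subst hlast
    have hAB : A = B := by
      have hfun : ∀ i, A.orderEmbOfFin (Finset.mem_powersetCard.1 hA).2 i =
          B.orderEmbOfFin (Finset.mem_powersetCard.1 hB).2 i := by
        intro i
        have := congrFun h0 i.castSucc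
        simpa [tupleOfFinset] using this
      rw [← Finset.coe_inj, ← Finset.range_orderEmbOfFin A (Finset.mem_powersetCard.1 hA).2,
        ← Finset.range_orderEmbOfFin B (Finset.mem_powersetCard.1 hB).2, funext hfun]
    subst hAB
    rfl
  · rintro ⟨t, hpos, hmono⟩
    have hf : StrictMono fun i : Fin a => t i.castSucc - 1 := by
      intro i j hij
      have h1 := hmono (Fin.castSucc_lt_castSucc_iff.2 hij)
      have h2 := hpos i.castSucc
      show t i.castSucc - 1 < t j.castSucc - 1
      omega
    set A : Finset ℕ := Finset.univ.image fun i : Fin a => t i.castSucc - 1 with hAdef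
    have hcard : A.card = a := by
      rw [hAdef, Finset.card_image_of_injective _ hf.injective, Finset.card_fin]
    have hA : A ∈ Finset.powersetCard a (Finset.range (t (Fin.last a) - 1)) := by
      refine Finset.mem_powersetCard.2 ⟨fun x hx => ?_, hcard⟩
      obtain ⟨i, -, rfl⟩ := Finset.mem_image.1 hx
      have h1 := hmono (Fin.castSucc_lt_last i)
      have h2 := hpos i.castSucc
      exact Finset.mem_range.2 (by omega)
    refine ⟨⟨t (Fin.last a) - 1, A, hA⟩, Subtype.ext (funext fun j => ?_)⟩
    have huniq := Finset.orderEmbOfFin_unique hcard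
      (fun i => Finset.mem_image_of_mem _ (Finset.mem_univ i)) hf
    induction j using Fin.lastCases with
    | last =>
      have := hpos (Fin.last a)
      simp only [tupleOfFinset, Fin.snoc_last]
      omega
    | cast i =>
      have h1 := congrFun huniq i
      have h2 := hpos i.castSucc
      simp only [tupleOfFinset, Fin.snoc_castSucc]
      rw [← h1]
      omega

theorem mplTerm_tupleOfFinset (a b : ℕ)
    (p : Σ m : ℕ, {A : Finset ℕ // A ∈ Finset.powersetCard a (Finset.range m)}) :
    mplTerm (-1) (onesThen a b) (tupleOfFinset a p) =
      (-1) ^ p.1 * (1 / ((p.1 : ℂ) + 1)) ^ b * ∏ j ∈ p.2.1, 1 / ((j : ℂ) + 1) := by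
  obtain ⟨m, A, hA⟩ := p
  have hprod : ∏ j ∈ A, 1 / ((j : ℂ) + 1) = ∏ i : Fin a,
      1 / ((A.orderEmbOfFin (Finset.mem_powersetCard.1 hA).2 i : ℂ) + 1) := by
    conv_lhs => rw [← Finset.image_orderEmbOfFin_univ A (Finset.mem_powersetCard.1 hA).2]
    rw [Finset.prod_image fun i _ j _ h => (A.orderEmbOfFin _).injective h]
  rw [hprod, Finset.prod_div_distrib, mplTerm, Fin.prod_univ_castSucc]
  simp [tupleOfFinset, onesThen]
  ring

theorem summable_one_div_pow_mul_coeff (a : ℕ) {b : ℕ} (hb : 2 ≤ b) :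
    Summable fun m : ℕ => ‖(-1) ^ m * (1 / ((m : ℂ) + 1)) ^ b *
      ((-1) ^ a * PowerSeries.coeff a (prodOneSub m))‖ := by
  refine Summable.of_nonneg_of_le (fun m => norm_nonneg _) (fun m => ?_)
    (summable_harmonicSum_pow_div_sq 0 le_rfl a)
  have hm : (0 : ℝ) ≤ m := m.cast_nonneg
  simp only [norm_mul, norm_pow, norm_neg, norm_one, one_pow, one_mul, norm_one_div_natCast_succ]
  refine mul_le_mul ?_ ((coeffLePow_prodOneSub m a).trans ?_) (norm_nonneg _) (by positivity)
  · rw [← one_div_pow]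
    exact pow_le_pow_of_le_one (by positivity) (by rw [div_le_one (by positivity)]; linarith) hb
  · refine pow_le_pow_left₀ (harmonicSum_nonneg m) ?_ a
    linarith [harmonicSum_mono m.le_succ, harmonicSum_nonneg m]

theorem norm_prod_one_div_succ (A : Finset ℕ) :
    ‖∏ j ∈ A, 1 / ((j : ℂ) + 1)‖ = ∏ j ∈ A, 1 / ((j : ℝ) + 1) := by
  rw [norm_prod]
  exact Finset.prod_congr rfl fun j _ => norm_one_div_natCast_succ j

theorem summable_mplTerm_onesThen (a : ℕ) {b : ℕ} (hb : 2 ≤ b) :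
    Summable (mplTerm (-1) (onesThen a b)) := by
  rw [← (Equiv.ofBijective _ (tupleOfFinset_bijective a)).summable_iff]
  refine Summable.of_norm ?_
  rw [summable_sigma_of_nonneg fun _ => norm_nonneg _]
  refine ⟨fun m => Summable.of_finite, (summable_one_div_pow_mul_coeff a hb).congr fun m => ?_⟩
  simp only [Function.comp_apply, Equiv.ofBijective_apply, mplTerm_tupleOfFinset]
  simp_rw [coeff_prodOneSub, norm_mul _ (Finset.prod _ _), norm_prod_one_div_succ]
  rw [tsum_mul_left, tsum_fintype, norm_mul]
  congr 1
  -- All terms are nonnegative reals, so the norm of the inner sum equals the sum of the norms.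
  have h : ∑ A ∈ Finset.powersetCard a (Finset.range m), ∏ j ∈ A, 1 / ((j : ℂ) + 1) =
      ((∑ A ∈ Finset.powersetCard a (Finset.range m), ∏ j ∈ A, 1 / ((j : ℝ) + 1) : ℝ) : ℂ) := by
    push_cast
    rfl
  rw [h, Complex.norm_of_nonneg
    (Finset.sum_nonneg fun _ _ => Finset.prod_nonneg fun _ _ => by positivity)]
  exact (Finset.sum_coe_sort _ _).symm

theorem hasSum_zetaMinus_onesThen (a : ℕ) {b : ℕ} (hb : 2 ≤ b) :
    HasSum (fun m : ℕ => (-1) ^ m * (1 / ((m : ℂ) + 1)) ^ b *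
      ((-1) ^ a * PowerSeries.coeff a (prodOneSub m))) (zetaMinus (onesThen a b)) := by
  have h := (Equiv.ofBijective _ (tupleOfFinset_bijective a)).hasSum_iff.2
    (summable_mplTerm_onesThen a hb).hasSum
  refine HasSum.sigma h fun m => ?_
  simp only [Function.comp_apply, Equiv.ofBijective_apply, mplTerm_tupleOfFinset]
  rw [coeff_prodOneSub, ← Finset.sum_coe_sort (Finset.powersetCard a (Finset.range m)),
    Finset.mul_sum]
  exact hasSum_fintype _

end Tuples

/-! ### The two sums and the reduction of the second to the first. -/

section Sums

theorem intBinom_natCast (n : ℤ) (k : ℕ) : intBinom n k = Ring.choose n k := by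
  simp [intBinom]

/-- Writing `2 - aX = (1 - aX) + 1` splits the series into `(1 - aX)^{-(s-1)} + (1 - aX)^{-s}`, one
for each binomial. -/
theorem coeff_geomSeries_pow_mul_two (a : ℂ) {s : ℕ} (hs : 1 ≤ s) (i : ℕ) :
    PowerSeries.coeff i (geomSeries a ^ s * (2 * oneSubMulX (a / 2))) =
      ((intBinom ((s : ℤ) - 2 + i) i + intBinom ((s : ℤ) - 1 + i) i : ℤ) : ℂ) * a ^ i := by
  obtain ⟨s, rfl⟩ := Nat.exists_eq_add_of_le' hs
  have h2 : (2 : ℂ⟦X⟧) * oneSubMulX (a / 2) = oneSubMulX a + 1 := by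
    have hC : (2 : ℂ⟦X⟧) * PowerSeries.C (a / 2) = PowerSeries.C a := by
      rw [← map_ofNat (PowerSeries.C (R := ℂ)), ← map_mul, mul_div_cancel₀ a two_ne_zero]
    rw [oneSubMulX, oneSubMulX, mul_sub, ← mul_assoc, hC]
    ring
  have h : geomSeries a ^ (s + 1) * (2 * oneSubMulX (a / 2)) =
      geomSeries a ^ s + geomSeries a ^ (s + 1) := by
    rw [h2]
    linear_combination geomSeries a ^ s * oneSubMulX_mul_geomSeries a
  rw [h, map_add, coeff_geomSeries_pow, coeff_geomSeries_pow, intBinom_natCast, intBinom_natCast,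
    show ((s + 1 : ℕ) : ℤ) - 2 + i = (s : ℤ) - 1 + i by push_cast; ring]
  push_cast
  ring

theorem first_sum_mem {s : ℕ} (hs : 1 ≤ s) (r : ℕ) :
    ∑ i ∈ Finset.range (r + 1),
        (-1 : ℂ) ^ (r - i) *
          ((intBinom ((s : ℤ) - 2 + i) i + intBinom ((s : ℤ) - 1 + i) i : ℤ) : ℂ) *
          zetaMinus (onesThen (r - i) (2 * s + i)) ∈ zetaAlgebra := by
  have h := hasSum_sum fun i (_ : i ∈ Finset.range (r + 1)) =>
    (hasSum_zetaMinus_onesThen (r - i) (b := 2 * s + i) (by omega)).mul_left ((-1 : ℂ) ^ (r - i) *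
          ((intBinom ((s : ℤ) - 2 + i) i + intBinom ((s : ℤ) - 1 + i) i : ℤ) : ℂ))
  rw [← h.tsum_eq]
  convert tsum_coeff_limitWeight_mem hs r using 1
  refine tsum_congr fun m => ?_
  have hf : limitWeight m * nodeInv m ^ s =
      PowerSeries.C ((-1) ^ m * (1 / ((m : ℂ) + 1)) ^ (2 * s)) *
        ((geomSeries (1 / ((m : ℂ) + 1)) ^ s * (2 * oneSubMulX (1 / ((m : ℂ) + 1) / 2))) *
          prodOneSub m) := by
    rw [div_div, mul_comm ((m : ℂ) + 1) 2]
    simp only [limitWeight, nodeInv, subXInv, map_mul, map_pow]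
    ring
  rw [hf, PowerSeries.coeff_C_mul, PowerSeries.coeff_mul,
    Finset.Nat.sum_antidiagonal_eq_sum_range_succ_mk, Finset.mul_sum]
  refine Finset.sum_congr rfl fun i _ => ?_
  rw [coeff_geomSeries_pow_mul_two _ hs]
  have h1 : ((-1 : ℂ) ^ (r - i)) * (-1) ^ (r - i) = 1 := by rw [← mul_pow]; simp
  linear_combination ((intBinom ((s : ℤ) - 2 + i) i + intBinom ((s : ℤ) - 1 + i) i : ℤ) : ℂ) *
    (-1) ^ m * (1 / ((m : ℂ) + 1)) ^ (2 * s + i) * PowerSeries.coeff (r - i) (prodOneSub m) * h1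

/-- The linear form `f ↦ ∑_{l ≤ r} (-2) ^ (r - l) [X ^ l] f · ζ₋({1}^(r - l), w + l)`. -/
noncomputable def zetaPairing (r w : ℕ) : ℂ⟦X⟧ →ₗ[ℂ] ℂ :=
  ∑ l ∈ Finset.range (r + 1),
    ((-2) ^ (r - l) * zetaMinus (onesThen (r - l) (w + l))) • PowerSeries.coeff l

theorem zetaPairing_apply (r w : ℕ) (f : ℂ⟦X⟧) :
    zetaPairing r w f = ∑ l ∈ Finset.range (r + 1),
      ((-2) ^ (r - l) * zetaMinus (onesThen (r - l) (w + l))) * PowerSeries.coeff l f := by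
  simp [zetaPairing]

/-- A factor `X^{2j}` trades `(r, 2s)` for `(r-2j, 2(s+j))`, so each term of the expansion again has
the shape of a first sum. -/
theorem zetaPairing_X_pow_mul (d r w : ℕ) (f : ℂ⟦X⟧) :
    zetaPairing (d + r) w (PowerSeries.X ^ d * f) = zetaPairing r (w + d) f := by
  rw [zetaPairing_apply, zetaPairing_apply, add_assoc, Finset.sum_range_add,
    Finset.sum_eq_zero, zero_add]
  · refine Finset.sum_congr rfl fun l _ => ?_
    rw [add_comm d l, PowerSeries.coeff_X_pow_mul, show d + r - (l + d) = r - l by omega,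
      show w + (l + d) = w + d + l by ring]
  · intro l hl
    rw [PowerSeries.coeff_X_pow_mul', if_neg (by simpa using hl), mul_zero]

theorem zetaPairing_X_pow_mul_of_lt {d r : ℕ} (h : r < d) (w : ℕ) (f : ℂ⟦X⟧) :
    zetaPairing r w (PowerSeries.X ^ d * f) = 0 := by
  rw [zetaPairing_apply]
  refine Finset.sum_eq_zero fun l hl => ?_
  rw [PowerSeries.coeff_X_pow_mul', if_neg (by have := Finset.mem_range.1 hl; omega), mul_zero]

/-- This is `2^r` times the first sum: the coefficient at `i` carries `2^i` and the pairing carries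
`(-2)^(r-i)`. -/
theorem zetaPairing_mem {s : ℕ} (hs : 1 ≤ s) (r : ℕ) :
    zetaPairing r (2 * s) (geomSeries 2 ^ s * (2 * oneSubMulX 1)) ∈ zetaAlgebra := by
  have h := mul_mem (pow_mem (ofNat_mem zetaAlgebra 2) r) (first_sum_mem hs r)
  convert h using 1
  rw [zetaPairing_apply, Finset.mul_sum]
  refine Finset.sum_congr rfl fun i hi => ?_
  have hc := coeff_geomSeries_pow_mul_two 2 hs i
  rw [div_self two_ne_zero] at hc
  have h2 : (2 : ℂ) ^ r = 2 ^ (r - i) * 2 ^ i := by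
    rw [← pow_add, Nat.sub_add_cancel (Nat.lt_succ_iff.1 (Finset.mem_range.1 hi))]
  rw [hc, h2, neg_pow]
  ring

theorem coeff_oneSubMulX_two_mul_geomSeries_pow (s i : ℕ) :
    PowerSeries.coeff i (oneSubMulX 2 * geomSeries 1 ^ (2 * s + 1) : ℂ⟦X⟧) =
      ((intBinom (2 * (s : ℤ) + i - 1) i - intBinom (2 * (s : ℤ) + i - 1) ((i : ℤ) - 1) : ℤ) : ℂ) := by
  have h : (oneSubMulX 2 * geomSeries 1 ^ (2 * s + 1) : ℂ⟦X⟧) =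
      geomSeries 1 ^ (2 * s) - PowerSeries.X * geomSeries 1 ^ (2 * s + 1) := by
    have h1 : (oneSubMulX 2 : ℂ⟦X⟧) = oneSubMulX 1 - PowerSeries.X := by
      simp only [oneSubMulX, map_one, map_ofNat]
      ring
    rw [h1]
    linear_combination geomSeries (1 : ℂ) ^ (2 * s) * oneSubMulX_mul_geomSeries (1 : ℂ)
  rw [h, map_sub, coeff_geomSeries_pow, intBinom_natCast]
  rcases i with _ | i
  · simp [intBinom]
  · rw [PowerSeries.coeff_succ_X_mul, coeff_geomSeries_pow,
      show ((i + 1 : ℕ) : ℤ) - 1 = (i : ℕ) by push_cast; ring, intBinom_natCast,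
      show ((2 * s : ℕ) : ℤ) - 1 + ((i + 1 : ℕ) : ℤ) = 2 * (s : ℤ) + ((i + 1 : ℕ) : ℤ) - 1 by
        push_cast; ring,
      show ((2 * s + 1 : ℕ) : ℤ) - 1 + (i : ℤ) = 2 * (s : ℤ) + ((i + 1 : ℕ) : ℤ) - 1 by
        push_cast; ring]
    simp

theorem second_sum_mem {s : ℕ} (hs : 1 ≤ s) (r : ℕ) :
    ∑ i ∈ Finset.range (r + 1),
        (-1 : ℂ) ^ (r - i) * 2 ^ (r - i + 1) *
          ((intBinom (2 * (s : ℤ) + i - 1) i - intBinom (2 * (s : ℤ) + i - 1) ((i : ℤ) - 1) : ℤ) : ℂ) *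
          zetaMinus (onesThen (r - i) (2 * s + i)) ∈ zetaAlgebra := by
  -- With `M = r / 2 + 1` one has `2M > r`, so the pairing kills the remainder, while `2j ≤ r` in
  -- every other term.
  obtain ⟨q, hq⟩ := exists_two_mul_oneSubMulX_expansion (R := ℂ) s (r / 2 + 1)
  have hpair : zetaPairing r (2 * s) (2 * (oneSubMulX 2 * geomSeries 1 ^ (2 * s + 1))) ∈
      zetaAlgebra := by
    rw [hq, map_add, map_sum, zetaPairing_X_pow_mul_of_lt (by omega), add_zero]
    refine sum_mem fun j hj => ?_
    obtain ⟨r', hr'⟩ := Nat.exists_eq_add_of_le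
      (show 2 * j ≤ r by have := Finset.mem_range.1 hj; omega)
    have hC : ((-1) ^ j * ((s + j).choose j : ℂ⟦X⟧)) =
        PowerSeries.C ((-1) ^ j * ((s + j).choose j : ℂ)) := by simp
    rw [hC, ← PowerSeries.smul_eq_C_mul, map_smul, hr', zetaPairing_X_pow_mul, ← mul_add,
      smul_eq_mul]
    exact mul_mem (mul_mem (pow_mem (neg_mem (one_mem _)) _) (natCast_mem _ _))
      (zetaPairing_mem (by omega) r')
  convert hpair using 1
  rw [zetaPairing_apply]
  refine Finset.sum_congr rfl fun i _ => ?_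
  rw [← map_ofNat (PowerSeries.C (R := ℂ)) 2, PowerSeries.coeff_C_mul,
    coeff_oneSubMulX_two_mul_geomSeries_pow, neg_pow (2 : ℂ), pow_succ]
  ring

end Sums

theorem theorem1 (r s : ℕ) (hs : 1 ≤ s) :
    (∀ i ∈ Finset.range (r + 1), Summable (mplTerm (-1) (onesThen (r - i) (2 * s + i)))) ∧
    IsRatPolyInZetaValues
      (∑ i ∈ Finset.range (r + 1),
        (-1 : ℂ) ^ (r - i) *
          ((intBinom ((s : ℤ) - 2 + i) i + intBinom ((s : ℤ) - 1 + i) i : ℤ) : ℂ) *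
          zetaMinus (onesThen (r - i) (2 * s + i))) ∧
    IsRatPolyInZetaValues
      (∑ i ∈ Finset.range (r + 1),
        (-1 : ℂ) ^ (r - i) * 2 ^ (r - i + 1) *
          ((intBinom (2 * (s : ℤ) + i - 1) i - intBinom (2 * (s : ℤ) + i - 1) ((i : ℤ) - 1) : ℤ) : ℂ) *
          zetaMinus (onesThen (r - i) (2 * s + i))) := by
  refine ⟨fun i _ => summable_mplTerm_onesThen _ (by omega), ?_, ?_⟩
  · exact isRatPolyInZetaValues_iff.2 (first_sum_mem hs r)
  · exact isRatPolyInZetaValues_iff.2 (second_sum_mem hs r)
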